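/- For a set $T \subseteq \mathbb{F}_3^n$ let $\mathcal{S}(T)$ be the set of non-degenerate three-term arithmetic progressions (3-APs) in $T$, that is, of triples $(x,y,z) \in T^3$ with pairwise distinct entries and $x - 2y + z = 0$; equivalently, of triples $(a, a+d, a+2d) \in T^3$ with $d \neq 0$. Put $s(T) = |\mathcal{S}(T)| / |\mathcal{S}(\mathbb{F}_3^n)|$. For a 3-coloring $\gamma : \mathbb{F}_3^n \to \{1,2,3\}$ with color classes $\gamma^{(1)}, \gamma^{(2)}, \gamma^{(3)}$, the density of monochromatic 3-APs is $s(\gamma^{(1)}) + s(\gamma^{(2)}) + s(\gamma^{(3)})$. Then the limit $$m_{3,3}(3\text{-AP}) = \lim_{n \to \infty} \, \min_{\gamma : \mathbb{F}_3^n \to \{1,2,3\}} \big( s(\gamma^{(1)}) + s(\gamma^{(2)}) + s(\gamma^{(3)}) \big)$$ exists and equals $1/27$. In particular 3-APs are not 3-common over $\mathbb{F}_3$, that is, $m_{3,3}(3\text{-AP}) \neq 3^{1-3} = 1/9$, where $1/9$ is, for every $n \geq 1$, the expected density of monochromatic 3-APs in a uniformly random 3-coloring of $\mathbb{F}_3^n$.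 Moreover, there is a 3-coloring of $\mathbb{F}_3^3$ without any non-degenerate monochromatic 3-AP. -/

import Mathlib

open Filter Topology

namespace RadoMultiplicity

section Solutions

variable {F : Type*} [Field F] [Fintype F] [DecidableEq F] {r m n c : ℕ}

/-- The solutions `s = (s₁, …, s_m) ∈ T ^ m` of `A s = 0` with pairwise distinct entries, where `A`
is an integer matrix with `r` rows and `m` columns and `T` is a set of points of `F ^ n`. -/
def solutions (A : Matrix (Fin r) (Fin m) ℤ) (T : Finset (Fin n → F)) :
    Finset (Fin m → (Fin n → F)) :=
  {s ∈ Fintype.piFinset (fun _ : Fin m => T) |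
    (∀ i, ∑ j, A i j • s j = 0) ∧ ∀ i j, i ≠ j → s i ≠ s j}

/-- The proportion of the solutions in `F ^ n` that lie entirely in `T`. -/
noncomputable def solutionDensity (A : Matrix (Fin r) (Fin m) ℤ) (T : Finset (Fin n → F)) : ℝ :=
  ((solutions A T).card : ℝ) /
    ((solutions A (Finset.univ : Finset (Fin n → F))).card : ℝ)

/-- The set of points that receive colour `i`. -/
def colorClass (γ : (Fin n → F) → Fin c) (i : Fin c) : Finset (Fin n → F) :=
  {x | γ x = i}

/-- The density of monochromatic solutions under the colouring `γ`. -/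
noncomputable def monoDensity (A : Matrix (Fin r) (Fin m) ℤ) (γ : (Fin n → F) → Fin c) : ℝ :=
  ∑ i, solutionDensity A (colorClass γ i)

end Solutions

section Multiplicity

variable (F : Type*) [Field F] [Fintype F] [DecidableEq F] (c : ℕ) [NeZero c] {r m : ℕ}

/-- The minimum density of monochromatic solutions over all `c`-colourings of `F ^ n`. -/
noncomputable def minMonoDensity (A : Matrix (Fin r) (Fin m) ℤ) (n : ℕ) : ℝ :=
  (Finset.univ : Finset ((Fin n → F) → Fin c)).inf' Finset.univ_nonempty
    (fun γ => monoDensity A γ)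

/-- `μ` is the Rado multiplicity of `A` over `F` for `c` colours: the minimum density of
monochromatic solutions over all `c`-colourings of `F ^ n` converges to `μ` as `n → ∞`. -/
def IsRadoMultiplicity (A : Matrix (Fin r) (Fin m) ℤ) (μ : ℝ) : Prop :=
  Tendsto (minMonoDensity F c A) atTop (𝓝 μ)

/-- `A` (with `m` columns) is `c`-common over `F`: its Rado multiplicity is `c ^ (1 - m)`. -/
def IsCommon (A : Matrix (Fin r) (Fin m) ℤ) : Prop :=
  IsRadoMultiplicity F c A ((c : ℝ) ^ (1 - (m : ℤ)))

end Multiplicity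

/-- The matrix of the equation `x - 2 y + z = 0` that defines three-term arithmetic
progressions. -/
def threeAP : Matrix (Fin 1) (Fin 3) ℤ := !![1, -2, 1]

/-- Over the field with three elements, the solutions with distinct entries are exactly the
progressions `(a, a + d, a + 2 d)` with `d ≠ 0`. -/
theorem mem_solutions_threeAP {n : ℕ} (T : Finset (Fin n → ZMod 3))
    (s : Fin 3 → (Fin n → ZMod 3)) :
    s ∈ solutions threeAP T ↔
      (∀ i, s i ∈ T) ∧ ∃ a d : Fin n → ZMod 3, d ≠ 0 ∧ s = ![a, a + d, a + (2 : ℤ) • d] := by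
  simp only [solutions, Finset.mem_filter, Fintype.mem_piFinset]
  refine and_congr_right fun _ => ⟨?_, ?_⟩
  · rintro ⟨h, hne⟩
    refine ⟨s 0, s 1 - s 0, sub_ne_zero.2 (hne 1 0 (by decide)), ?_⟩
    have h0 := h 0
    simp only [threeAP, Fin.sum_univ_three, Matrix.of_apply, Matrix.cons_val] at h0
    funext i
    fin_cases i
    · rfl
    · simp
    · simp only [Fin.reduceFinMk, Matrix.cons_val]
      rw [← sub_eq_zero, ← h0]
      module
  · rintro ⟨a, d, hd, rfl⟩
    have h2 : (2 : ℤ) • d ≠ 0 := by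
      intro h
      apply hd
      have h3 : (3 : ℤ) • d = 0 := by
        funext k
        simp only [Pi.smul_apply, zsmul_eq_mul, Pi.zero_apply]
        have : ((3 : ℤ) : ZMod 3) = 0 := by decide
        rw [this, zero_mul]
      have : d = (3 : ℤ) • d - (2 : ℤ) • d := by module
      rw [this, h, h3, sub_zero]
    have h1 : (2 : ℤ) • d ≠ d := by
      intro h
      apply hd
      have : d = (2 : ℤ) • d - d := by module
      rw [this, h, sub_self]
    constructor
    · intro i
      fin_cases i
      simp only [threeAP, Fin.sum_univ_three, Matrix.of_apply, Matrix.cons_val, Fin.zero_eta]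
      module
    · intro i j hij
      fin_cases i <;> fin_cases j <;> first | exact absurd rfl hij | skip
      all_goals simp [hd, h2, h1, Ne.symm h1, -zsmul_eq_mul]

end RadoMultiplicity

namespace RadoMultiplicity

/-! ### Sums over a finite group under translation and reflection. -/

section Shift

variable {V : Type*} [AddCommGroup V] [Fintype V]

/-! Three colours in `ZMod 3` sum to zero iff they are all equal or all distinct, so the number of
equal pairs among them is 1 + 3[all equal] - [sum zero]. Summing over all N² progressions,
degenerate ones included, and using that at least N²/3 ordered pairs of points share a colour, the
monochromatic count is at least a third of the zero-sum count Z. The core is Z ≥ N²/9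
(`card_sq_le_sum_zeroCount`): a finitely checked inequality on planes is averaged over all pairs of
directions, then combined with Cauchy–Schwarz. The bound N²/27 is attained for n ≥ 3 by lifting a
progression-free colouring of F₃³ (`paraboloid`). Removing the N degenerate triples gives the exact
minimum (N/27 - 1)/(N - 1), with N = 3ⁿ. -/

theorem sum_add_left_eq (F : V → ℤ) (d : V) : ∑ e, F (d + e) = ∑ e, F e :=
  Equiv.sum_comp (Equiv.addLeft d) F

theorem sum_add_right_eq (F : V → ℤ) (d : V) : ∑ e, F (e + d) = ∑ e, F e :=
  Equiv.sum_comp (Equiv.addRight d) F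

theorem sum_sub_left_eq (F : V → ℤ) (d : V) : ∑ e, F (d - e) = ∑ e, F e :=
  Equiv.sum_comp (Equiv.subLeft d) F

theorem sum_sub_right_eq (F : V → ℤ) (d : V) : ∑ e, F (e - d) = ∑ e, F e :=
  Equiv.sum_comp (Equiv.subRight d) F

theorem sum_sum_four (F : V → ℤ) :
    ∑ d, ∑ e, (F d + F e + F (d + e) + F (d - e)) = 4 * Fintype.card V * ∑ d, F d := by
  simp only [Finset.sum_add_distrib, sum_add_left_eq, sum_sub_left_eq, Finset.sum_const,
    Finset.card_univ, nsmul_eq_mul, ← Finset.mul_sum]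
  ring

end Shift

/-- Cauchy–Schwarz applied to the sizes of the three colour classes. -/
theorem card_sq_le_three_mul_sum_eq {V : Type*} [Fintype V] (g : V → ZMod 3) :
    (Fintype.card V : ℤ) ^ 2 ≤ 3 * ∑ x, ∑ y, if g x = g y then 1 else 0 := by
  have hfib : ∑ x, ∑ y, (if g x = g y then (1 : ℤ) else 0) =
      ∑ c : ZMod 3, (∑ x, if g x = c then (1 : ℤ) else 0) ^ 2 := by
    have hpt : ∀ a b : ZMod 3, (if a = b then (1 : ℤ) else 0) =
        ∑ c, (if a = c then 1 else 0) * (if b = c then 1 else 0) := by decide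
    simp only [sq, Finset.sum_mul_sum]
    rw [Finset.sum_comm (s := (Finset.univ : Finset (ZMod 3)))]
    refine Finset.sum_congr rfl fun x _ => ?_
    rw [Finset.sum_comm (s := (Finset.univ : Finset (ZMod 3)))]
    exact Finset.sum_congr rfl fun y _ => hpt (g x) (g y)
  have htot : ∑ c : ZMod 3, ∑ x, (if g x = c then (1 : ℤ) else 0) = Fintype.card V := by
    rw [Finset.sum_comm]
    simp
  have hCS := sq_sum_le_card_mul_sum_sq (s := (Finset.univ : Finset (ZMod 3)))
    (f := fun c => ∑ x, if g x = c then (1 : ℤ) else 0)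
  rw [htot, Finset.card_univ, ZMod.card] at hCS
  rw [hfib]
  exact_mod_cast hCS

/-! ### Zero-sum and monochromatic progressions: the lower bound. -/

section LineSum

variable {V : Type*} [AddCommGroup V] [Module (ZMod 3) V]

/-- The sum of the colours on the progression `x, x + d, x - d`. -/
def lineSum (g : V → ZMod 3) (x d : V) : ZMod 3 := g x + g (x + d) + g (x - d)

/-- The indicator of `0`. -/
def zeroInd (t : ZMod 3) : ℤ := if t = 0 then 1 else 0

/-- The odd function on `ZMod 3` with value `1` at `1`. -/
def oddSign (t : ZMod 3) : ℤ := if t = 0 then 0 else if t = 1 then 1 else -1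

/-- The sum of `f (lineSum g x _)` over the four directions of the plane spanned by `d, e`. -/
def pencilSum (f : ZMod 3 → ℤ) (g : V → ZMod 3) (x d e : V) : ℤ :=
  f (lineSum g x d) + f (lineSum g x e) + f (lineSum g x (d + e)) + f (lineSum g x (d - e))

/-- The local expression whose average over a plane is nonnegative. -/
def pencilForm (g : V → ZMod 3) (x d e : V) : ℤ :=
  12 * pencilSum zeroInd g x d e - 3 * pencilSum zeroInd g x d e ^ 2
    - pencilSum oddSign g x d e ^ 2

theorem zmod_three_eq_zero : (3 : ZMod 3) = 0 := by decide

/-- Three values are normalized to zero, which leaves 3⁶ functions to check. -/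
theorem pencilForm_normalized_nonneg : ∀ a b c d e f : ZMod 3,
    0 ≤ ∑ p : ZMod 3 × ZMod 3, pencilForm
      (fun q => (![![0, 0, a], ![0, b, c], ![d, e, f]] : Fin 3 → Fin 3 → ZMod 3) q.1 q.2)
      p (1, 0) (0, 1) := by
  decide +kernel

/-- An affine function sums to zero along every progression in characteristic 3; this justifies the
normalization. -/
theorem lineSum_sub_affine (h : ZMod 3 × ZMod 3 → ZMod 3) (α β δ : ZMod 3)
    (p v : ZMod 3 × ZMod 3) :
    lineSum (fun q => h q - (α + β * q.1 + δ * q.2)) p v = lineSum h p v := by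
  simp only [lineSum, Prod.fst_add, Prod.snd_add, Prod.fst_sub, Prod.snd_sub]
  linear_combination (-(α + β * p.1 + δ * p.2)) * zmod_three_eq_zero

/-- The plane inequality. -/
theorem sum_pencilForm_plane_nonneg (h : ZMod 3 × ZMod 3 → ZMod 3) :
    0 ≤ ∑ p : ZMod 3 × ZMod 3, pencilForm h p (1, 0) (0, 1) := by
  set h' : ZMod 3 × ZMod 3 → ZMod 3 := fun q =>
    h q - (h (0, 0) + (h (1, 0) - h (0, 0)) * q.1 + (h (0, 1) - h (0, 0)) * q.2) with hh'
  have key := pencilForm_normalized_nonneg (h' (0, 2)) (h' (1, 1)) (h' (1, 2)) (h' (2, 0))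
    (h' (2, 1)) (h' (2, 2))
  have hfun : (fun q : ZMod 3 × ZMod 3 => (![![0, 0, h' (0, 2)], ![0, h' (1, 1), h' (1, 2)],
      ![h' (2, 0), h' (2, 1), h' (2, 2)]] : Fin 3 → Fin 3 → ZMod 3) q.1 q.2) = h' := by
    have h00 : h' (0, 0) = 0 := by simp [hh']
    have h01 : h' (0, 1) = 0 := by simp [hh']
    have h10 : h' (1, 0) = 0 := by simp [hh']
    funext ⟨i, j⟩
    change Fin 3 at i
    change Fin 3 at j
    fin_cases i <;> fin_cases j <;> first | rfl | exact h00.symm | exact h01.symm | exact h10.symm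
  rw [hfun] at key
  simpa only [pencilForm, pencilSum, hh', lineSum_sub_affine] using key

theorem lineSum_pullback (g : V → ZMod 3) (x d e : V) (p v : ZMod 3 × ZMod 3) :
    lineSum (fun q : ZMod 3 × ZMod 3 => g (x + (q.1 • d + q.2 • e))) p v =
      lineSum g (x + (p.1 • d + p.2 • e)) (v.1 • d + v.2 • e) := by
  simp only [lineSum, Prod.fst_add, Prod.snd_add, Prod.fst_sub, Prod.snd_sub]
  congr 1
  · congr 2
    module
  · congr 1
    module

theorem sub_eq_add_add (x d : V) : x - d = x + d + d := by
  have h3 : (3 : ZMod 3) • d = 0 := by rw [zmod_three_eq_zero, zero_smul]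
  rw [← sub_eq_zero, ← neg_eq_zero, ← h3]
  module

variable [Fintype V]

theorem sum_pencilForm_nonneg (g : V → ZMod 3) :
    0 ≤ ∑ d, ∑ e, ∑ x, pencilForm g x d e := by
  refine Finset.sum_nonneg fun d _ => Finset.sum_nonneg fun e _ => ?_
  -- Each of the nine shifts `p` merely translates `x`, so this sum is nine times the one wanted.
  -- The pullback needs no independence of `d` and `e`.
  have key : 0 ≤ ∑ x : V, ∑ p : ZMod 3 × ZMod 3,
      pencilForm g (x + (p.1 • d + p.2 • e)) d e := by
    refine Finset.sum_nonneg fun x _ => ?_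
    have := sum_pencilForm_plane_nonneg (fun q => g (x + (q.1 • d + q.2 • e)))
    simpa [pencilForm, pencilSum, lineSum_pullback, sub_eq_add_neg] using this
  rw [Finset.sum_comm] at key
  simp only [sum_add_right_eq (fun x => pencilForm g x d e), Finset.sum_const, Finset.card_univ,
    nsmul_eq_mul] at key
  exact nonneg_of_mul_nonneg_right key (by simp [Fintype.card_prod, ZMod.card])

/-- Any two of the four directions `d, e, d + e, d - e` are independent. -/
theorem sum_sum_four_sq (F : V → ℤ) :
    ∑ d, ∑ e, (F d + F e + F (d + e) + F (d - e)) ^ 2 =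
      4 * Fintype.card V * ∑ d, F d ^ 2 + 12 * (∑ d, F d) ^ 2 := by
  have hsq := sum_sum_four (fun d => F d ^ 2)
  have h1 : ∑ d, ∑ e, F d * F e = (∑ d, F d) ^ 2 := by
    rw [sq, Finset.sum_mul_sum]
  have h2 : ∑ d, ∑ e, F d * F (d + e) = (∑ d, F d) ^ 2 := by
    simp only [← Finset.mul_sum, sum_add_left_eq, ← Finset.sum_mul, sq]
  have h3 : ∑ d, ∑ e, F d * F (d - e) = (∑ d, F d) ^ 2 := by
    simp only [← Finset.mul_sum, sum_sub_left_eq, ← Finset.sum_mul, sq]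
  have h4 : ∑ d, ∑ e, F e * F (d + e) = (∑ d, F d) ^ 2 := by
    rw [Finset.sum_comm]
    simp only [← Finset.mul_sum, sum_add_right_eq, ← Finset.sum_mul, sq]
  have h5 : ∑ d, ∑ e, F e * F (d - e) = (∑ d, F d) ^ 2 := by
    rw [Finset.sum_comm]
    simp only [← Finset.mul_sum, sum_sub_right_eq, ← Finset.sum_mul, sq]
  have h6 : ∑ d, ∑ e, F (d + e) * F (d - e) = (∑ d, F d) ^ 2 := by
    -- Substituting e - d for e, together with 2d = -d, decouples the two arguments.
    have hd : ∀ d : V, ∑ e, F (d + e) * F (d - e) = ∑ e, F e * F (-e - d) := fun d => by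
      rw [← sum_add_left_eq (fun e => F e * F (-e - d)) d]
      refine Finset.sum_congr rfl fun e _ => ?_
      rw [sub_eq_add_add (-(d + e)) d]
      congr 2
      abel
    simp only [hd]
    rw [Finset.sum_comm]
    simp only [← Finset.mul_sum, sum_sub_left_eq, ← Finset.sum_mul, sq]
  have hexp : ∑ d, ∑ e, (F d + F e + F (d + e) + F (d - e)) ^ 2 =
      ∑ d, ∑ e, (F d ^ 2 + F e ^ 2 + F (d + e) ^ 2 + F (d - e) ^ 2) +
      2 * (∑ d, ∑ e, F d * F e + ∑ d, ∑ e, F d * F (d + e) + ∑ d, ∑ e, F d * F (d - e) +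
        ∑ d, ∑ e, F e * F (d + e) + ∑ d, ∑ e, F e * F (d - e) +
        ∑ d, ∑ e, F (d + e) * F (d - e)) := by
    simp only [Finset.mul_sum, ← Finset.sum_add_distrib]
    refine Finset.sum_congr rfl fun d _ => Finset.sum_congr rfl fun e _ => ?_
    ring
  rw [hexp, hsq, h1, h2, h3, h4, h5, h6]
  ring

/-- The number of directions `d` in which the progression at `x` has line sum `0`. -/
def zeroCount (g : V → ZMod 3) (x : V) : ℤ := ∑ d, zeroInd (lineSum g x d)

/-- With z = `zeroCount g x`, the right side is 4(9z - N)(N - z) minus a nonnegative square, which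
is what forces z to be at least N/9 on average. -/
theorem sum_pencilForm_eq (g : V → ZMod 3) (x : V) :
    ∑ d, ∑ e, pencilForm g x d e =
      40 * Fintype.card V * zeroCount g x - 36 * zeroCount g x ^ 2 - 4 * Fintype.card V ^ 2
        - 12 * (∑ d, oddSign (lineSum g x d)) ^ 2 := by
  have hz : ∀ t, zeroInd t ^ 2 = zeroInd t := by decide
  have ho : ∀ t, oddSign t ^ 2 = 1 - zeroInd t := by decide
  have h1 := sum_sum_four (fun d => zeroInd (lineSum g x d))
  have h2 := sum_sum_four_sq (fun d => zeroInd (lineSum g x d))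
  have h3 := sum_sum_four_sq (fun d => oddSign (lineSum g x d))
  simp only [hz, ho, Finset.sum_sub_distrib, Finset.sum_const, Finset.card_univ,
    nsmul_eq_mul] at h2 h3
  simp only [pencilForm, pencilSum, Finset.sum_sub_distrib, ← Finset.mul_sum]
  rw [h1, h2, h3]
  simp only [zeroCount]
  ring

/-- At least a ninth of the progressions have line sum `0`. -/
theorem card_sq_le_sum_zeroCount (g : V → ZMod 3) :
    (Fintype.card V : ℤ) ^ 2 ≤ 9 * ∑ x, zeroCount g x := by
  have h0 := sum_pencilForm_nonneg g
  have hcomm : ∑ d, ∑ e, ∑ x, pencilForm g x d e = ∑ x, ∑ d, ∑ e, pencilForm g x d e := by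
    simp_rw [Finset.sum_comm (s := Finset.univ (α := V)) (f := fun e x => pencilForm g x _ e)]
    rw [Finset.sum_comm]
  rw [hcomm] at h0
  simp only [sum_pencilForm_eq, Finset.sum_sub_distrib, ← Finset.mul_sum, Finset.sum_const,
    Finset.card_univ, nsmul_eq_mul] at h0
  have hU : 0 ≤ ∑ x, (∑ d, oddSign (lineSum g x d)) ^ 2 :=
    Finset.sum_nonneg fun x _ => sq_nonneg _
  have hCS := sq_sum_le_card_mul_sum_sq (s := (Finset.univ : Finset V)) (f := zeroCount g)
  rw [Finset.card_univ] at hCS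
  have hN : (0 : ℤ) < Fintype.card V := by exact_mod_cast Fintype.card_pos
  set N : ℤ := ((Fintype.card V : ℕ) : ℤ)
  set S := ∑ x, zeroCount g x
  set Q := ∑ x, zeroCount g x ^ 2
  by_contra! hlt
  have hQ : 9 * Q ≤ 10 * N * S - N ^ 3 := by nlinarith
  -- Multiply `hQ` by N and use S² ≤ NQ. If 9S < N², the first factor is negative and the second
  -- positive.
  have hprod : 0 ≤ (9 * S - N ^ 2) * (N ^ 2 - S) := by nlinarith
  nlinarith [sq_nonneg N, pow_pos hN 2]

/-- The number of progressions, including the degenerate ones, that are monochromatic. -/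
def monoCount (g : V → ZMod 3) : ℤ :=
  ∑ x, ∑ d, if g x = g (x + d) ∧ g x = g (x - d) then 1 else 0

/-- At least a twenty-seventh of the progressions are monochromatic. -/
theorem card_sq_le_monoCount (g : V → ZMod 3) :
    (Fintype.card V : ℤ) ^ 2 ≤ 27 * monoCount g := by
  have hpt : ∀ a b c : ZMod 3,
      (if a = b then (1 : ℤ) else 0) + (if a = c then 1 else 0) + (if b = c then 1 else 0) =
        1 + 3 * (if a = b ∧ a = c then 1 else 0) - zeroInd (a + b + c) := by decide
  have hsum : ∑ x, ∑ d, ((if g x = g (x + d) then (1 : ℤ) else 0) +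
      (if g x = g (x - d) then 1 else 0) + (if g (x + d) = g (x - d) then 1 else 0)) =
      (Fintype.card V : ℤ) ^ 2 + 3 * monoCount g - ∑ x, zeroCount g x := by
    simp only [hpt, Finset.sum_sub_distrib, Finset.sum_add_distrib, ← Finset.mul_sum,
      Finset.sum_const, Finset.card_univ, nsmul_eq_mul, mul_one, sq, monoCount, zeroCount,
      lineSum]
  have h1 : ∀ x, ∑ d, (if g x = g (x + d) then (1 : ℤ) else 0) =
      ∑ y, if g x = g y then 1 else 0 :=
    fun x => sum_add_left_eq (fun y => if g x = g y then 1 else 0) x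
  have h2 : ∀ x, ∑ d, (if g x = g (x - d) then (1 : ℤ) else 0) =
      ∑ y, if g x = g y then 1 else 0 :=
    fun x => sum_sub_left_eq (fun y => if g x = g y then 1 else 0) x
  have h3 : ∑ x, ∑ d, (if g (x + d) = g (x - d) then (1 : ℤ) else 0) =
      ∑ x, ∑ y, if g x = g y then 1 else 0 := by
    -- For fixed `d`, translating `x` by `d` turns the pair (x, x - d) into (x + d, x), and x - d =
    -- x + d + d.
    rw [← Finset.sum_congr rfl fun x _ => h2 x, Finset.sum_comm]
    conv_rhs => rw [Finset.sum_comm]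
    refine Finset.sum_congr rfl fun d _ => ?_
    rw [← sum_add_right_eq _ d]
    refine Finset.sum_congr rfl fun x _ => ?_
    rw [← sub_eq_add_add, add_sub_cancel_right]
    simp only [eq_comm]
  simp only [Finset.sum_add_distrib, h1, h2, h3] at hsum
  have hα := card_sq_le_three_mul_sum_eq g
  have hS := card_sq_le_sum_zeroCount g
  linarith

end LineSum

/-! ### From counts to densities; the extremal and the random colouring. -/

section Count

variable {n : ℕ}

/-- The pairs `(a, d)` with `d ≠ 0` for which `a, a + d, a - d` have the same colour. -/
def monoPairs (γ : (Fin n → ZMod 3) → Fin 3) : Finset ((Fin n → ZMod 3) × (Fin n → ZMod 3)) :=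
  {p | p.2 ≠ 0 ∧ γ p.1 = γ (p.1 + p.2) ∧ γ p.1 = γ (p.1 - p.2)}

theorem add_two_zsmul (a d : Fin n → ZMod 3) : a + (2 : ℤ) • d = a - d := by
  rw [sub_eq_add_add, two_zsmul, add_assoc]

theorem card_solutions_threeAP (T : Finset (Fin n → ZMod 3)) :
    (solutions threeAP T).card =
      (Finset.univ.filter fun p : (Fin n → ZMod 3) × (Fin n → ZMod 3) =>
        p.2 ≠ 0 ∧ p.1 ∈ T ∧ p.1 + p.2 ∈ T ∧ p.1 - p.2 ∈ T).card := by
  symm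
  refine Finset.card_bij (fun p _ => ![p.1, p.1 + p.2, p.1 + (2 : ℤ) • p.2]) ?_ ?_ ?_
  · rintro ⟨a, d⟩ h
    simp only [Finset.mem_filter, Finset.mem_univ, true_and] at h
    refine (mem_solutions_threeAP T _).2 ⟨?_, a, d, h.1, rfl⟩
    intro i
    fin_cases i
    · exact h.2.1
    · exact h.2.2.1
    · simpa [add_two_zsmul, -zsmul_eq_mul] using h.2.2.2
  · rintro ⟨a, d⟩ - ⟨b, e⟩ - h
    have h0 : a = b := congrFun h 0
    have h1 : a + d = b + e := congrFun h 1
    subst h0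
    rw [add_left_cancel h1]
  · intro s hs
    obtain ⟨hT, a, d, hd, rfl⟩ := (mem_solutions_threeAP T s).1 hs
    refine ⟨(a, d), ?_, rfl⟩
    have h2 := hT 2
    simp only [Matrix.cons_val, add_two_zsmul] at h2
    simpa using ⟨hd, hT 0, hT 1, h2⟩

theorem card_solutions_univ :
    ((solutions threeAP (Finset.univ : Finset (Fin n → ZMod 3))).card : ℝ) =
      (3 : ℝ) ^ n * ((3 : ℝ) ^ n - 1) := by
  have hset : (Finset.univ.filter fun p : (Fin n → ZMod 3) × (Fin n → ZMod 3) => p.2 ≠ 0) =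
      Finset.univ ×ˢ Finset.univ.erase 0 := by
    ext p
    simp
  rw [card_solutions_threeAP]
  simp only [Finset.mem_univ, and_true]
  rw [hset, Finset.card_product, Finset.card_erase_of_mem (Finset.mem_univ _)]
  simp [Nat.cast_sub (Nat.one_le_pow n 3 (by norm_num)), ZMod.card]

theorem sum_card_solutions (γ : (Fin n → ZMod 3) → Fin 3) :
    ∑ i, (solutions threeAP (colorClass γ i)).card = (monoPairs γ).card := by
  rw [Finset.card_eq_sum_card_fiberwise (f := fun p => γ p.1) (t := Finset.univ)
    (fun _ _ => Finset.mem_coe.2 (Finset.mem_univ _))]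
  refine Finset.sum_congr rfl fun i _ => ?_
  rw [card_solutions_threeAP]
  congr 1
  ext p
  simp only [colorClass, monoPairs, Finset.mem_filter, Finset.mem_univ, true_and]
  constructor
  · rintro ⟨h, h0, h1, h2⟩
    exact ⟨⟨h, h0.trans h1.symm, h0.trans h2.symm⟩, h0⟩
  · rintro ⟨⟨h, h1, h2⟩, h0⟩
    exact ⟨h, h0, h1.symm.trans h0, h2.symm.trans h0⟩

theorem monoDensity_threeAP (γ : (Fin n → ZMod 3) → Fin 3) :
    monoDensity threeAP γ = (monoPairs γ).card / ((3 : ℝ) ^ n * ((3 : ℝ) ^ n - 1)) := by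
  simp only [monoDensity, solutionDensity]
  rw [← Finset.sum_div, card_solutions_univ, ← sum_card_solutions, Nat.cast_sum]

theorem monoCount_eq (γ : (Fin n → ZMod 3) → Fin 3) :
    monoCount (V := Fin n → ZMod 3) γ = (monoPairs γ).card + 3 ^ n := by
  have hsplit : ∀ x d : Fin n → ZMod 3,
      (if γ x = γ (x + d) ∧ γ x = γ (x - d) then (1 : ℤ) else 0) =
        (if d ≠ 0 ∧ γ x = γ (x + d) ∧ γ x = γ (x - d) then 1 else 0) +
          if d = 0 then 1 else 0 := by
    intro x d
    by_cases hd : d = 0 <;> simp [hd]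
  have hmono : monoCount (V := Fin n → ZMod 3) γ =
      ∑ x, ∑ d, if γ x = γ (x + d) ∧ γ x = γ (x - d) then (1 : ℤ) else 0 := rfl
  rw [hmono]
  simp only [hsplit, Finset.sum_add_distrib]
  congr 1
  · rw [monoPairs, Finset.card_filter, Nat.cast_sum, Fintype.sum_prod_type]
    simp
  · simp [ZMod.card]

theorem monoDensity_ge (hn : 1 ≤ n) (γ : (Fin n → ZMod 3) → Fin 3) :
    ((3 : ℝ) ^ n / 27 - 1) / ((3 : ℝ) ^ n - 1) ≤ monoDensity threeAP γ := by
  have h := card_sq_le_monoCount (V := Fin n → ZMod 3) γ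
  rw [monoCount_eq] at h
  have hR : ((3 : ℝ) ^ n) ^ 2 ≤ 27 * ((monoPairs γ).card + 3 ^ n) := by
    have : ((3 : ℤ) ^ n) ^ 2 ≤ 27 * ((monoPairs γ).card + 3 ^ n) := by
      simpa [ZMod.card] using h
    exact_mod_cast this
  have hN : (1 : ℝ) < 3 ^ n := one_lt_pow₀ (by norm_num) (by omega)
  rw [monoDensity_threeAP, div_le_div_iff₀ (by linarith) (by nlinarith)]
  have hpos : 0 < (3 : ℝ) ^ n - 1 := by linarith
  nlinarith

/-- The colouring of `F₃ ^ 3` whose classes are translates of an elliptic paraboloid. -/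
def paraboloid (v : Fin 3 → ZMod 3) : Fin 3 := (v 2 - v 0 ^ 2 - v 1 ^ 2 : ZMod 3)

/-- The second difference in direction `d` forces d₀² + d₁² = 0. As -1 is not a square mod 3, d₀ =
d₁ = 0, and then d₂ = 0. -/
theorem paraboloid_eq_zero (a d : Fin 3 → ZMod 3)
    (h1 : paraboloid a = paraboloid (a + d)) (h2 : paraboloid a = paraboloid (a - d)) :
    d = 0 := by
  have key : ∀ a₀ a₁ a₂ d₀ d₁ d₂ : ZMod 3,
      a₂ - a₀ ^ 2 - a₁ ^ 2 = (a₂ + d₂) - (a₀ + d₀) ^ 2 - (a₁ + d₁) ^ 2 →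
      a₂ - a₀ ^ 2 - a₁ ^ 2 = (a₂ - d₂) - (a₀ - d₀) ^ 2 - (a₁ - d₁) ^ 2 →
      d₀ = 0 ∧ d₁ = 0 ∧ d₂ = 0 := by decide +kernel
  obtain ⟨h0, h1, h2⟩ := key (a 0) (a 1) (a 2) (d 0) (d 1) (d 2) h1 h2
  funext i
  fin_cases i <;> assumption

theorem solutions_paraboloid (i : Fin 3) :
    solutions threeAP (colorClass paraboloid i) = ∅ := by
  have h : (monoPairs paraboloid).card = 0 := by
    rw [Finset.card_eq_zero, monoPairs, Finset.filter_eq_empty_iff]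
    rintro ⟨a, d⟩ - ⟨hd, h1, h2⟩
    exact hd (paraboloid_eq_zero a d h1 h2)
  rw [← sum_card_solutions, Finset.sum_eq_zero_iff] at h
  exact Finset.card_eq_zero.1 (h i (Finset.mem_univ i))

theorem exists_monoDensity_eq (n : ℕ) :
    ∃ γ : (Fin (n + 3) → ZMod 3) → Fin 3, monoDensity threeAP γ =
      ((3 : ℝ) ^ (n + 3) / 27 - 1) / ((3 : ℝ) ^ (n + 3) - 1) := by
  let π : (Fin (n + 3) → ZMod 3) → (Fin 3 → ZMod 3) := fun v i => v (Fin.natAdd n i)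
  refine ⟨fun v => paraboloid (π v), ?_⟩
  -- A progression is monochromatic exactly when its projection to F₃³ is constant.
  have hset : monoPairs (fun v => paraboloid (π v)) =
      Finset.univ ×ˢ ((Finset.univ.filter fun d => π d = 0).erase 0) := by
    ext ⟨a, d⟩
    simp only [monoPairs, Finset.mem_filter, Finset.mem_univ, true_and, Finset.mem_product,
      Finset.mem_erase]
    refine and_congr_right fun _ => ⟨fun h => paraboloid_eq_zero (π a) (π d) h.1 h.2, fun h => ?_⟩
    have hadd : π (a + d) = π a := by
      change π a + π d = π a
      rw [h, add_zero]
    have hsub : π (a - d) = π a := by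
      change π a - π d = π a
      rw [h, sub_zero]
    rw [hadd, hsub]
    exact ⟨rfl, rfl⟩
  have hker : (Finset.univ.filter fun d => π d = 0).card = 3 ^ n := by
    have : Fintype.card (Fin n → ZMod 3) = 3 ^ n := by simp [ZMod.card]
    rw [← this, ← Finset.card_univ]
    symm
    refine Finset.card_bij (fun u _ => Fin.append u (0 : Fin 3 → ZMod 3)) ?_ ?_ ?_
    · intro u _
      simp only [Finset.mem_filter, Finset.mem_univ, true_and]
      funext i
      simp [π]
    · intro u _ v _ h
      funext i
      simpa using congrFun h (Fin.castAdd 3 i)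
    · intro d hd
      simp only [Finset.mem_filter, Finset.mem_univ, true_and] at hd
      refine ⟨fun i => d (Fin.castAdd 3 i), Finset.mem_univ _, ?_⟩
      rw [← hd]
      exact Fin.append_castAdd_natAdd
  have h0 : (0 : Fin (n + 3) → ZMod 3) ∈ Finset.univ.filter fun d => π d = 0 := by
    simp only [Finset.mem_filter, Finset.mem_univ, true_and]
    rfl
  rw [monoDensity_threeAP, hset, Finset.card_product, Finset.card_erase_of_mem h0, hker,
    Nat.cast_mul, Nat.cast_sub (Nat.one_le_pow n 3 (by norm_num))]
  have hN : (1 : ℝ) < 3 ^ (n + 3) := one_lt_pow₀ (by norm_num) (by omega)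
  have hcard : ((Finset.univ : Finset (Fin (n + 3) → ZMod 3)).card : ℝ) = 3 ^ (n + 3) := by
    simp [ZMod.card]
  rw [hcard, mul_div_mul_left _ _ (by positivity)]
  congr 1
  push_cast
  ring

theorem minMonoDensity_threeAP (n : ℕ) :
    minMonoDensity (ZMod 3) 3 threeAP (n + 3) =
      ((3 : ℝ) ^ (n + 3) / 27 - 1) / ((3 : ℝ) ^ (n + 3) - 1) := by
  refine le_antisymm ?_ ?_
  · obtain ⟨γ, hγ⟩ := exists_monoDensity_eq n
    rw [← hγ]
    exact Finset.inf'_le _ (Finset.mem_univ γ)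
  · exact Finset.le_inf' _ _ fun γ _ => monoDensity_ge (by omega) γ

theorem isRadoMultiplicity_threeAP : IsRadoMultiplicity (ZMod 3) 3 threeAP (1 / 27) := by
  -- The exact formula is available only from dimension 3 on.
  rw [IsRadoMultiplicity, ← tendsto_add_atTop_iff_nat 3]
  simp only [minMonoDensity_threeAP]
  have hpow : Tendsto (fun n : ℕ => (1 / 3 : ℝ) ^ (n + 3)) atTop (𝓝 0) :=
    (tendsto_add_atTop_iff_nat 3).2
      (tendsto_pow_atTop_nhds_zero_of_lt_one (by norm_num) (by norm_num))
  have hlim : Tendsto (fun n : ℕ => (1 / 27 - (1 / 3 : ℝ) ^ (n + 3)) / (1 - (1 / 3 : ℝ) ^ (n + 3)))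
      atTop (𝓝 ((1 / 27 - 0) / (1 - 0))) :=
    (tendsto_const_nhds.sub hpow).div (tendsto_const_nhds.sub hpow) (by norm_num)
  rw [sub_zero, sub_zero, div_one] at hlim
  refine hlim.congr fun n => ?_
  have hN : (3 : ℝ) ^ (n + 3) ≠ 0 := by positivity
  rw [one_div_pow, ← mul_div_mul_left _ _ hN]
  congr 1 <;> field_simp

/-- A ninth of all colourings are constant on three given points. -/
theorem nine_mul_card_colorings {V : Type*} [Fintype V] [DecidableEq V] {a b c : V}
    (hab : a ≠ b) (hac : a ≠ c) (hbc : b ≠ c) :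
    9 * (Finset.univ.filter fun γ : V → Fin 3 => γ a = γ b ∧ γ a = γ c).card =
      Fintype.card (V → Fin 3) := by
  have hfib := Finset.card_eq_sum_card_fiberwise (s := (Finset.univ : Finset (V → Fin 3)))
    (f := fun γ => (γ b - γ a, γ c - γ a)) (t := Finset.univ)
    (fun _ _ => Finset.mem_coe.2 (Finset.mem_univ _))
  have hconst : ∀ st : Fin 3 × Fin 3,
      (Finset.univ.filter fun γ : V → Fin 3 => (γ b - γ a, γ c - γ a) = st).card =
        (Finset.univ.filter fun γ : V → Fin 3 => γ a = γ b ∧ γ a = γ c).card := by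
    have hpt : ∀ s t x y z : Fin 3, y - x = s ∧ z - x = t ↔ x = y - s ∧ x = z - t := by decide
    rintro ⟨s, t⟩
    -- Recolouring `b` and `c` by shifts matches each fibre of colour differences with the fibre
    -- over (0, 0).
    refine Finset.card_equiv (Equiv.subRight (Pi.single b s + Pi.single c t)) fun γ => ?_
    simp only [Finset.mem_filter, Finset.mem_univ, true_and, Equiv.subRight_apply, Pi.sub_apply,
      Pi.add_apply, Pi.single_eq_same, Pi.single_eq_of_ne hab, Pi.single_eq_of_ne hac,
      Pi.single_eq_of_ne hbc, Pi.single_eq_of_ne hbc.symm, add_zero, zero_add, sub_zero,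
      Prod.mk.injEq]
    exact hpt s t (γ a) (γ b) (γ c)
  simp only [hconst, Finset.sum_const, Finset.card_univ, smul_eq_mul] at hfib
  rw [hfib]
  simp [Fintype.card_prod]

theorem nine_mul_sum_card_monoPairs (n : ℕ) :
    9 * ∑ γ : (Fin n → ZMod 3) → Fin 3, (monoPairs γ).card =
      (Finset.univ.filter fun p : (Fin n → ZMod 3) × (Fin n → ZMod 3) => p.2 ≠ 0).card *
        Fintype.card ((Fin n → ZMod 3) → Fin 3) := by
  have hswap : ∑ γ : (Fin n → ZMod 3) → Fin 3, (monoPairs γ).card =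
      ∑ p ∈ Finset.univ.filter fun p : (Fin n → ZMod 3) × (Fin n → ZMod 3) => p.2 ≠ 0,
        (Finset.univ.filter fun γ : (Fin n → ZMod 3) → Fin 3 =>
          γ p.1 = γ (p.1 + p.2) ∧ γ p.1 = γ (p.1 - p.2)).card := by
    simp only [monoPairs, Finset.card_filter, Finset.sum_filter]
    rw [Finset.sum_comm]
    refine Finset.sum_congr rfl fun p _ => ?_
    by_cases hp : p.2 = 0 <;> simp [hp]
  rw [hswap, Finset.mul_sum, Finset.card_eq_sum_ones, Finset.sum_mul]
  refine Finset.sum_congr rfl fun p hp => ?_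
  have hd : p.2 ≠ 0 := (Finset.mem_filter.1 hp).2
  rw [one_mul]
  refine nine_mul_card_colorings (by simpa using hd) (fun h => hd (sub_eq_self.1 h.symm)) ?_
  rw [sub_eq_add_add]
  simpa using hd

theorem average_monoDensity (hn : 1 ≤ n) :
    (∑ γ : (Fin n → ZMod 3) → Fin 3, monoDensity threeAP γ) /
      (Fintype.card ((Fin n → ZMod 3) → Fin 3) : ℝ) = 1 / 9 := by
  have hN : (1 : ℝ) < 3 ^ n := one_lt_pow₀ (by norm_num) (by omega)
  have huniv := card_solutions_univ (n := n)
  rw [card_solutions_threeAP] at huniv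
  simp only [Finset.mem_univ, and_true] at huniv
  have h9 := congrArg (Nat.cast (R := ℝ)) (nine_mul_sum_card_monoPairs n)
  rw [Nat.cast_mul, Nat.cast_mul, huniv, Nat.cast_sum] at h9
  simp only [monoDensity_threeAP]
  rw [← Finset.sum_div]
  have hC : (Fintype.card ((Fin n → ZMod 3) → Fin 3) : ℝ) ≠ 0 :=
    Nat.cast_ne_zero.2 Fintype.card_ne_zero
  have hP : (3 : ℝ) ^ n * ((3 : ℝ) ^ n - 1) ≠ 0 := by
    have : (3 : ℝ) ^ n - 1 ≠ 0 := by linarith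
    positivity
  rw [div_div, div_eq_div_iff (mul_ne_zero hP hC) (by norm_num), one_mul, ← h9]
  push_cast
  ring

theorem not_isCommon_threeAP : ¬ IsCommon (ZMod 3) 3 threeAP := by
  intro h
  have := tendsto_nhds_unique h isRadoMultiplicity_threeAP
  norm_num at this

end Count

end RadoMultiplicity

/-- The Rado multiplicity of three-term arithmetic progressions in 3-colourings of `F₃ ^ n` is
`1 / 27`; hence they are not 3-common, a uniformly random colouring having expected monochromatic
density `1 / 9`; and some 3-colouring of `F₃ ^ 3` has no monochromatic progression at all. -/
theorem theorem1 :
    RadoMultiplicity.IsRadoMultiplicity (ZMod 3) 3 RadoMultiplicity.threeAP (1 / 27) ∧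
    ¬ RadoMultiplicity.IsCommon (ZMod 3) 3 RadoMultiplicity.threeAP ∧
    (∀ n : ℕ, 1 ≤ n →
      (∑ γ : (Fin n → ZMod 3) → Fin 3,
          RadoMultiplicity.monoDensity RadoMultiplicity.threeAP γ) /
        (Fintype.card ((Fin n → ZMod 3) → Fin 3) : ℝ) = 1 / 9) ∧
    (∃ γ : (Fin 3 → ZMod 3) → Fin 3, ∀ i : Fin 3,
      RadoMultiplicity.solutions RadoMultiplicity.threeAP
        (RadoMultiplicity.colorClass γ i) = ∅) := by
  exact ⟨RadoMultiplicity.isRadoMultiplicity_threeAP, RadoMultiplicity.not_isCommon_threeAP,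
    fun _ hn => RadoMultiplicity.average_monoDensity hn,
    RadoMultiplicity.paraboloid, RadoMultiplicity.solutions_paraboloid⟩
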